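/- Let $m\ge 1$, $\nu>m-1$, $\rho^2>0$, $\mu_0\in\mathbb{R}^m$, and let $\Sigma_0\in\mathbb{R}^{m\times m}$ be symmetric positive definite. For $x^n=(x_1,\dots,x_n)\in(\mathbb{R}^m)^n$, $\mu\in\mathbb{R}^m$ and symmetric positive definite $\Sigma\in\mathbb{R}^{m\times m}$ put $$f(x^n;\mu,\Sigma)=\frac{1}{(2\pi)^{mn/2}|\Sigma|^{n/2}}\exp\Big\{-\tfrac12\sum_{i=1}^n(x_i-\mu)^\top\Sigma^{-1}(x_i-\mu)\Big\},$$ $$\pi(\mu,\Sigma)=\frac{1}{(2\pi)^{m\nu/2}|\Sigma|^{\nu/2}}\exp\Big[-\tfrac{\nu}{2}\operatorname{tr}\big\{\Sigma^{-1}\big(\Sigma_0+\rho^2(\mu-\mu_0)(\mu-\mu_0)^\top\big)\big\}\Big].$$ The normalized maximum likelihood density with luckiness $\pi$ (LNML) of $n$ observations is $$\bar p_n(x^n)=\frac{\max_{\mu,\Sigma}f(x^n;\mu,\Sigma)\,\pi(\mu,\Sigma)}{C_n},\qquad C_n=\int_{(\mathbb{R}^m)^n}\max_{\mu,\Sigma}f(y^n;\mu,\Sigma)\,\pi(\mu,\Sigma)\,dy^n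 .$$ For $n\ge 0$ let $$\bar\mu_n=\mu_0+\frac{1}{n+\rho^2\nu}\sum_{i=1}^n(x_i-\mu_0),$$ $$\bar\Sigma_n=\frac{1}{n+\nu}\Big(\sum_{i=1}^n(x_i-\mu_0)(x_i-\mu_0)^\top+\nu\Sigma_0\Big)-\frac{1}{(\nu+n)(\rho^2\nu+n)}\sum_{i,j=1}^n(x_i-\mu_0)(x_j-\mu_0)^\top .$$ Let $$t_d(y\mid\mu,\Sigma)=\frac{\Gamma(\frac{d+m}{2})}{\Gamma(\frac d2)(d\pi)^{m/2}|\Sigma|^{1/2}}\Big(1+\tfrac1d(y-\mu)^\top\Sigma^{-1}(y-\mu)\Big)^{-(d+m)/2}$$ be the density of the multivariate $t$-distribution on $\mathbb{R}^m$ with $d>0$ degrees of freedom, location $\mu$ and positive definite scale $\Sigma$. Then, for every $n$ and every $x^n$, the maximum defining $\bar p_n(x^n)$ is attained at $(\bar\mu_n,\bar\Sigma_n)$, with $\bar\Sigma_n$ positive definite, and $0<C_n<\infty$; moreover $$\bar p_n(x^n)=\prod_{i=1}^n t_{\nu-m+i}\big(x_i\mid\bar\mu_{i-1},\,c_i\bar\Sigma_{i-1}\big),\qquad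 c_i=\frac{(\rho^2\nu+i)(\nu+i-1)}{(\rho^2\nu+i-1)(\nu-m+i)},$$ where $\bar\mu_{i-1},\bar\Sigma_{i-1}$ are computed from $x_1,\dots,x_{i-1}$, and every factor is a multivariate $t$ density with positive degrees of freedom and positive definite scale, so that it integrates to $1$ in $x_i$. The factors do not depend on $n$, and the LNML defines an exchangeable process: there is exactly one probability measure on the space of sequences $(x_1,x_2,\dots)$ in $\mathbb{R}^m$ under which, for every $n$, $(x_1,\dots,x_n)$ has density $\bar p_n$ with respect to Lebesgue measure, and this measure is invariant under all permutations of finitely many indices. -/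

import Mathlib

open MeasureTheory
open scoped Matrix

noncomputable section

namespace LNML

/-! ### Normalized maximum likelihood with luckiness, for a parametrized model -/

section General

variable {Θ X : Type*}

/-- The maximized product of likelihood and luckiness, `max_θ p_θ(x) π(θ)`, written as a supremum;
that the maximum is attained is asserted separately wherever it is needed. -/
def maxLikelihood (p : Θ → X → ℝ) (luck : Θ → ℝ) (x : X) : ℝ :=
  ⨆ θ, p θ x * luck θ

/-- The normalizing constant (capacity) `∫ max_θ p_θ(x) π(θ) dx`. -/
def capacity [MeasureSpace X] (p : Θ → X → ℝ) (luck : Θ → ℝ) : ℝ :=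
  ∫ x, maxLikelihood p luck x

/-- The LNML density of the model `p` with luckiness `luck`. -/
def density [MeasureSpace X] (p : Θ → X → ℝ) (luck : Θ → ℝ) (x : X) : ℝ :=
  maxLikelihood p luck x / capacity p luck

end General

/-! ### The multivariate normal model -/

/-- Parameters `(μ, Σ)` of the `m`-dimensional normal distributions: an arbitrary mean and a
(symmetric) positive definite covariance matrix. -/
abbrev NormalParam (m : ℕ) : Type :=
  (Fin m → ℝ) × {S : Matrix (Fin m) (Fin m) ℝ // S.PosDef}

/-- The density `f(xⁿ; μ, Σ)` of `n` independent `m`-dimensional normal observations. -/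
def normalDensity {m n : ℕ} (θ : NormalParam m) (x : Fin n → Fin m → ℝ) : ℝ :=
  1 / ((2 * Real.pi) ^ ((m : ℝ) * n / 2) * (θ.2 : Matrix (Fin m) (Fin m) ℝ).det ^ ((n : ℝ) / 2)) *
    Real.exp (-(1 / 2) * ∑ i, (x i - θ.1) ⬝ᵥ
      ((θ.2 : Matrix (Fin m) (Fin m) ℝ)⁻¹ *ᵥ (x i - θ.1)))

/-- The luckiness `π(μ, Σ; ν, μ₀, Σ₀, ρ²)`. -/
def luckiness {m : ℕ} (ν : ℝ) (μ₀ : Fin m → ℝ) (S₀ : Matrix (Fin m) (Fin m) ℝ) (ρ : ℝ)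
    (θ : NormalParam m) : ℝ :=
  1 / ((2 * Real.pi) ^ ((m : ℝ) * ν / 2) * (θ.2 : Matrix (Fin m) (Fin m) ℝ).det ^ (ν / 2)) *
    Real.exp (-(ν / 2) * Matrix.trace ((θ.2 : Matrix (Fin m) (Fin m) ℝ)⁻¹ *
      (S₀ + ρ ^ 2 • Matrix.vecMulVec (θ.1 - μ₀) (θ.1 - μ₀))))

/-- The LNML density `p̄ₙ(xⁿ)` of `n` observations from the `m`-dimensional normal model with
luckiness `π(·; ν, μ₀, Σ₀, ρ²)`, with respect to Lebesgue measure on `(ℝᵐ)ⁿ`. -/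
def normalLNML {m : ℕ} (ν : ℝ) (μ₀ : Fin m → ℝ) (S₀ : Matrix (Fin m) (Fin m) ℝ) (ρ : ℝ)
    {n : ℕ} (x : Fin n → Fin m → ℝ) : ℝ :=
  density normalDensity (luckiness ν μ₀ S₀ ρ) x

/-- `μ̄ₙ = μ₀ + (n + ρ²ν)⁻¹ ∑ᵢ (xᵢ - μ₀)`. -/
def mapMean {m : ℕ} (ν : ℝ) (μ₀ : Fin m → ℝ) (ρ : ℝ) {n : ℕ} (x : Fin n → Fin m → ℝ) :
    Fin m → ℝ :=
  μ₀ + (1 / (n + ρ ^ 2 * ν)) • ∑ i, (x i - μ₀)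

/-- `Σ̄ₙ = (n + ν)⁻¹ (∑ᵢ (xᵢ - μ₀)(xᵢ - μ₀)ᵀ + νΣ₀)
  - ((ν + n)(ρ²ν + n))⁻¹ ∑ᵢⱼ (xᵢ - μ₀)(xⱼ - μ₀)ᵀ`. -/
def mapCov {m : ℕ} (ν : ℝ) (μ₀ : Fin m → ℝ) (S₀ : Matrix (Fin m) (Fin m) ℝ) (ρ : ℝ)
    {n : ℕ} (x : Fin n → Fin m → ℝ) : Matrix (Fin m) (Fin m) ℝ :=
  (1 / (n + ν)) • (∑ i, Matrix.vecMulVec (x i - μ₀) (x i - μ₀) + ν • S₀) -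
    (1 / ((ν + n) * (ρ ^ 2 * ν + n))) •
      ∑ i, ∑ j, Matrix.vecMulVec (x i - μ₀) (x j - μ₀)

/-! ### Multivariate t densities and the sequential factors -/

/-- The density `t_d(y | μ, Σ)` of the `m`-dimensional t-distribution with `d` degrees of freedom,
location `μ` and scale matrix `Σ`. -/
def tDensity {m : ℕ} (d : ℝ) (μ : Fin m → ℝ) (S : Matrix (Fin m) (Fin m) ℝ) (y : Fin m → ℝ) : ℝ :=
  Real.Gamma ((d + m) / 2) /
      (Real.Gamma (d / 2) * (d * Real.pi) ^ ((m : ℝ) / 2) * S.det ^ ((1 : ℝ) / 2)) *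
    (1 + 1 / d * ((y - μ) ⬝ᵥ (S⁻¹ *ᵥ (y - μ)))) ^ (-((d + m) / 2))

/-- The degrees of freedom `ν - m + i` of the `i`-th factor, `i = 1, 2, …`. -/
def tDof (m : ℕ) (ν : ℝ) (i : ℕ) : ℝ := ν - m + i

/-- The scalar `cᵢ = (ρ²ν + i)(ν + i - 1) / ((ρ²ν + i - 1)(ν - m + i))`, `i = 1, 2, …`. -/
def scaleFactor (m : ℕ) (ν ρ : ℝ) (i : ℕ) : ℝ :=
  ((ρ ^ 2 * ν + i) * (ν + i - 1)) / ((ρ ^ 2 * ν + i - 1) * (ν - m + i))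

/-- The sequential factor for observation number `i = k + 1` given the previous observations
`z = (x₁, …, x_k)`, namely `y ↦ t_{ν-m+i}(y | μ̄_{i-1}, cᵢ Σ̄_{i-1})`. It does not involve the total
number of observations. -/
def predictiveDensity {m : ℕ} (ν : ℝ) (μ₀ : Fin m → ℝ) (S₀ : Matrix (Fin m) (Fin m) ℝ) (ρ : ℝ)
    {k : ℕ} (z : Fin k → Fin m → ℝ) (y : Fin m → ℝ) : ℝ :=
  tDensity (tDof m ν (k + 1)) (mapMean ν μ₀ ρ z)
    (scaleFactor m ν ρ (k + 1) • mapCov ν μ₀ S₀ ρ z) y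

/-! ### Exchangeable processes -/

/-- The law `P` of a sequence of `E`-valued random variables is exchangeable if it is invariant
under all permutations of the time indices that move only finitely many of them. -/
def Exchangeable {E : Type*} [MeasurableSpace E] (P : Measure (ℕ → E)) : Prop :=
  ∀ σ : Equiv.Perm ℕ, {i | σ i ≠ i}.Finite → P.map (fun ω i => ω (σ i)) = P

end LNML

end

/-! Completing the square in the mean (`scatter_eq`) turns likelihood times luckiness into a
function of the covariance alone, times a Gaussian factor centred at `mapMean`. That factor is at
most one, and the rest is maximized at `mapCov` because `|W| ≤ exp(tr W - m)` for positive definite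
`W`. The maximum is therefore a constant times `|mapCov|^(-(n+ν)/2)`.

One more observation rescales `mapCov` and adds a rank-one term (`mapCov_snoc`). By the matrix
determinant lemma the ratio of consecutive maxima is, up to a constant, a t density in the new
observation (`exists_maxValue_snoc`), so the maximum is a constant times a product of t densities.
Each factor has integral one, hence so does the product, and the constant must be the capacity; it
is never computed.

The t factors serve as the transition kernels of an Ionescu-Tulcea process, whose marginals are the
LNML densities. Exchangeability comes from the other description of these densities: the maximized
likelihood is symmetric in the observations. -/

namespace LNML

/-! ### Determinant and trace inequalities, rank-one updates -/

section LinearAlgebra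

variable {m : ℕ}

/-- In terms of eigenvalues this is the product of the inequalities `t ≤ exp (t - 1)`. -/
theorem det_le_exp_trace_sub {W : Matrix (Fin m) (Fin m) ℝ} (hW : W.PosDef) :
    W.det ≤ Real.exp (W.trace - m) := by
  rw [hW.isHermitian.det_eq_prod_eigenvalues, hW.isHermitian.trace_eq_sum_eigenvalues]
  have h : (∑ i, (hW.isHermitian.eigenvalues i : ℝ)) - m
      = ∑ i, (hW.isHermitian.eigenvalues i - 1) := by
    simp [Finset.sum_sub_distrib]
  simp only [RCLike.ofReal_real_eq_id, id]
  rw [h, Real.exp_sum]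
  refine Finset.prod_le_prod (fun i _ => (hW.eigenvalues_pos i).le) fun i _ => ?_
  have := Real.add_one_le_exp (hW.isHermitian.eigenvalues i - 1)
  linarith

open scoped MatrixOrder in
theorem exists_transpose_mul_self {S : Matrix (Fin m) (Fin m) ℝ} (hS : S.PosDef) :
    ∃ B : Matrix (Fin m) (Fin m) ℝ, B.det ≠ 0 ∧ S = Bᵀ * B := by
  obtain ⟨B, hB⟩ := CStarAlgebra.nonneg_iff_eq_star_mul_self.1
    (Matrix.nonneg_iff_posSemidef.2 hS.posSemidef)
  have hB' : S = Bᵀ * B := hB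
  refine ⟨B, fun h => ?_, hB'⟩
  have := hS.det_pos
  rw [hB', Matrix.det_mul, h, mul_zero] at this
  exact lt_irrefl _ this

theorem dotProduct_transpose_mul_self_mulVec (B : Matrix (Fin m) (Fin m) ℝ) (v : Fin m → ℝ) :
    v ⬝ᵥ ((Bᵀ * B) *ᵥ v) = (B *ᵥ v) ⬝ᵥ (B *ᵥ v) := by
  rw [← Matrix.mulVec_mulVec, Matrix.dotProduct_mulVec, Matrix.vecMul_transpose]

theorem dotProduct_mulVec_nonneg {S : Matrix (Fin m) (Fin m) ℝ} (hS : S.PosDef) (v : Fin m → ℝ) :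
    0 ≤ v ⬝ᵥ (S *ᵥ v) := by
  simpa using hS.posSemidef.dotProduct_mulVec_nonneg v

/-- The function `S ↦ |S|^{-N/2} exp(-(N/2) tr(S⁻¹A))` is maximal at `S = A`. -/
theorem det_rpow_mul_exp_trace_le {S A : Matrix (Fin m) (Fin m) ℝ} (hS : S.PosDef) (hA : A.PosDef)
    {N : ℝ} (hN : 0 < N) :
    S.det ^ (-(N / 2)) * Real.exp (-(N / 2) * (S⁻¹ * A).trace) ≤
      A.det ^ (-(N / 2)) * Real.exp (-(N / 2) * m) := by
  -- `S⁻¹ * A` need not be symmetric; `B * A * Bᵀ` is positive definite with the same trace and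
  -- determinant.
  obtain ⟨B, hB0, hB⟩ := exists_transpose_mul_self hS.inv
  have hW : (B * A * Bᵀ).PosDef := by
    refine hA.mul_mul_conjTranspose_same (B := B) ?_
    exact Matrix.vecMul_injective_of_isUnit ((Matrix.isUnit_iff_isUnit_det B).2 hB0.isUnit)
  have htr : (S⁻¹ * A).trace = (B * A * Bᵀ).trace := by
    rw [hB, Matrix.mul_assoc, Matrix.trace_mul_comm]
  have hdet : (B * A * Bᵀ).det = S.det⁻¹ * A.det := by
    have h1 : (S⁻¹).det = S.det⁻¹ := by rw [Matrix.det_nonsing_inv, Ring.inverse_eq_inv']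
    rw [← h1, hB]
    simp only [Matrix.det_mul]
    ring
  have hle := det_le_exp_trace_sub hW
  rw [hdet, ← htr] at hle
  have hSd := hS.det_pos
  have hAd := hA.det_pos
  have h2 : (S.det⁻¹ * A.det) ^ (N / 2) ≤ Real.exp ((S⁻¹ * A).trace - m) ^ (N / 2) :=
    Real.rpow_le_rpow (by positivity) hle (by positivity)
  rw [Real.mul_rpow (by positivity) hAd.le, Real.inv_rpow hSd.le, ← Real.rpow_neg hSd.le,
    ← Real.exp_mul] at h2
  have h3 : A.det ^ (N / 2) * A.det ^ (-(N / 2)) = 1 := by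
    rw [← Real.rpow_add hAd]; simp
  calc S.det ^ (-(N / 2)) * Real.exp (-(N / 2) * (S⁻¹ * A).trace)
      = (S.det ^ (-(N / 2)) * A.det ^ (N / 2)) *
          (A.det ^ (-(N / 2)) * Real.exp (-(N / 2) * (S⁻¹ * A).trace)) := by
        rw [show ∀ a b c d : ℝ, (a * b) * (c * d) = (b * c) * (a * d) by intros; ring, h3, one_mul]
    _ ≤ Real.exp (((S⁻¹ * A).trace - m) * (N / 2)) *
          (A.det ^ (-(N / 2)) * Real.exp (-(N / 2) * (S⁻¹ * A).trace)) :=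
        mul_le_mul_of_nonneg_right h2 (by positivity)
    _ = A.det ^ (-(N / 2)) * Real.exp (-(N / 2) * m) := by
        rw [show ∀ a b c : ℝ, a * (b * c) = b * (a * c) by intros; ring, ← Real.exp_add]
        congr 2
        ring

/-- The matrix determinant lemma; it produces the quadratic form inside the t density. -/
theorem det_add_smul_vecMulVec {A : Matrix (Fin m) (Fin m) ℝ} (hA : A.det ≠ 0) (k : ℝ)
    (u : Fin m → ℝ) :
    (A + k • Matrix.vecMulVec u u).det = A.det * (1 + k * (u ⬝ᵥ (A⁻¹ *ᵥ u))) := by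
  have h := Matrix.det_add_replicateCol_mul_replicateRow (ι := Unit) hA.isUnit (k • u) u
  rw [← Matrix.vecMulVec_eq, Matrix.smul_vecMulVec] at h
  rw [h]
  congr 2
  rw [Matrix.det_unique, Matrix.add_apply, Matrix.one_apply_eq, Matrix.mul_assoc,
    ← Matrix.replicateCol_mulVec, Matrix.replicateRow_mul_replicateCol_apply, Matrix.mulVec_smul,
    dotProduct_smul, smul_eq_mul]

theorem posDef_add_smul_vecMulVec {A : Matrix (Fin m) (Fin m) ℝ} (hA : A.PosDef) {k : ℝ}
    (hk : 0 ≤ k) (u : Fin m → ℝ) : (A + k • Matrix.vecMulVec u u).PosDef := by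
  refine hA.add_posSemidef (Matrix.PosSemidef.smul ?_ hk)
  simpa using Matrix.posSemidef_vecMulVec_self_star u

theorem trace_mul_vecMulVec (S : Matrix (Fin m) (Fin m) ℝ) (u : Fin m → ℝ) :
    (S * Matrix.vecMulVec u u).trace = u ⬝ᵥ (S *ᵥ u) := by
  rw [Matrix.mul_vecMulVec, Matrix.trace_vecMulVec, dotProduct_comm]

end LinearAlgebra

/-! ### The maximizer and the maximal value -/

section MapEstimates

variable {m : ℕ} (ν : ℝ) (μ₀ : Fin m → ℝ) (S₀ : Matrix (Fin m) (Fin m) ℝ) (ρ : ℝ)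

theorem mapMean_apply {n : ℕ} (x : Fin n → Fin m → ℝ) (a : Fin m) :
    mapMean ν μ₀ ρ x a = μ₀ a + (∑ i, (x i a - μ₀ a)) / (n + ρ ^ 2 * ν) := by
  simp [mapMean, Finset.sum_apply]
  ring

theorem mapCov_apply {n : ℕ} (x : Fin n → Fin m → ℝ) (a b : Fin m) :
    mapCov ν μ₀ S₀ ρ x a b = (1 / (n + ν)) *
      (∑ i, (x i a - μ₀ a) * (x i b - μ₀ b) + ν * S₀ a b -
        1 / (n + ρ ^ 2 * ν) * ((∑ i, (x i a - μ₀ a)) * ∑ i, (x i b - μ₀ b))) := by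
  simp only [mapCov, Matrix.sub_apply, Matrix.smul_apply, Matrix.add_apply, Matrix.sum_apply,
    Matrix.vecMulVec_apply, Pi.sub_apply, smul_eq_mul, Finset.sum_mul_sum]
  rw [add_comm ν, add_comm (ρ ^ 2 * ν), ← one_div_mul_one_div]
  ring

variable {ν ρ}

/-- Entrywise, a rational identity in the new observation and the first and second moments of the
old ones. -/
theorem mapCov_snoc (hν : 0 < ν) (hρ : 0 < ρ ^ 2) {n : ℕ} (z : Fin n → Fin m → ℝ)
    (y : Fin m → ℝ) :
    mapCov ν μ₀ S₀ ρ (Fin.snoc z y : Fin (n + 1) → Fin m → ℝ) =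
      ((n + ν) / (n + 1 + ν)) • (mapCov ν μ₀ S₀ ρ z +
        ((n + ρ ^ 2 * ν) / ((n + 1 + ρ ^ 2 * ν) * (n + ν))) •
          Matrix.vecMulVec (y - mapMean ν μ₀ ρ z) (y - mapMean ν μ₀ ρ z)) := by
  ext a b
  have h1 : (n + ν : ℝ) ≠ 0 := by positivity
  have h2 : (n + 1 + ν : ℝ) ≠ 0 := by positivity
  have h3 : (n + ρ ^ 2 * ν : ℝ) ≠ 0 := by positivity
  have h4 : (n + 1 + ρ ^ 2 * ν : ℝ) ≠ 0 := by positivity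
  simp only [mapCov_apply, mapMean_apply, Matrix.smul_apply, Matrix.add_apply,
    Matrix.vecMulVec_apply, Pi.sub_apply, smul_eq_mul, Fin.sum_univ_castSucc, Fin.snoc_castSucc,
    Fin.snoc_last, Nat.cast_add, Nat.cast_one]
  generalize ∑ i, (z i a - μ₀ a) * (z i b - μ₀ b) = T
  generalize ∑ i, (z i a - μ₀ a) = s
  generalize ∑ i, (z i b - μ₀ b) = t
  field_simp
  ring

/-- The definition subtracts a term, which hides positivity; the recursion `mapCov_snoc` only adds
positive semidefinite terms, starting from `S₀`. -/
theorem posDef_mapCov (hν : 0 < ν) (hρ : 0 < ρ ^ 2) (hS₀ : S₀.PosDef) {n : ℕ}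
    (x : Fin n → Fin m → ℝ) : (mapCov ν μ₀ S₀ ρ x).PosDef := by
  induction n with
  | zero =>
    convert hS₀
    ext a b
    rw [mapCov_apply]
    simp [hν.ne']
  | succ n ih =>
    rw [← Fin.snoc_init_self x, mapCov_snoc μ₀ S₀ hν hρ]
    exact (posDef_add_smul_vecMulVec (ih _) (by positivity) _).smul (by positivity)

/-- The left side is quadratic in `μ` with leading coefficient `n + ρ²ν`; completing the square
gives the centre `mapMean` and the remainder `(n + ν) • mapCov`. -/
theorem scatter_eq (hν : 0 < ν) (hρ : 0 < ρ ^ 2) {n : ℕ} (x : Fin n → Fin m → ℝ)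
    (μ : Fin m → ℝ) :
    ∑ i, Matrix.vecMulVec (x i - μ) (x i - μ) +
        ν • (S₀ + ρ ^ 2 • Matrix.vecMulVec (μ - μ₀) (μ - μ₀)) =
      (n + ν : ℝ) • mapCov ν μ₀ S₀ ρ x + (n + ρ ^ 2 * ν : ℝ) •
        Matrix.vecMulVec (μ - mapMean ν μ₀ ρ x) (μ - mapMean ν μ₀ ρ x) := by
  ext a b
  have h1 : (n + ν : ℝ) ≠ 0 := by positivity
  have h3 : (n + ρ ^ 2 * ν : ℝ) ≠ 0 := by positivity
  have key : ∑ i, (x i a - μ a) * (x i b - μ b) = ∑ i, (x i a - μ₀ a) * (x i b - μ₀ b) -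
      (∑ i, (x i a - μ₀ a)) * (μ b - μ₀ b) - (μ a - μ₀ a) * (∑ i, (x i b - μ₀ b)) +
      n * ((μ a - μ₀ a) * (μ b - μ₀ b)) := by
    rw [Finset.sum_mul, Finset.mul_sum, ← Finset.sum_sub_distrib, ← Finset.sum_sub_distrib]
    conv_rhs => rw [show (n : ℝ) * ((μ a - μ₀ a) * (μ b - μ₀ b)) =
      ∑ _i : Fin n, (μ a - μ₀ a) * (μ b - μ₀ b) by simp]
    rw [← Finset.sum_add_distrib]
    exact Finset.sum_congr rfl fun i _ => by ring
  simp only [Matrix.add_apply, Matrix.smul_apply, Matrix.sum_apply, Matrix.vecMulVec_apply,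
    Pi.sub_apply, smul_eq_mul, mapCov_apply, mapMean_apply, key]
  generalize ∑ i, (x i a - μ₀ a) * (x i b - μ₀ b) = T
  generalize ∑ i, (x i a - μ₀ a) = s
  generalize ∑ i, (x i b - μ₀ b) = t
  field_simp
  ring

/-- The product of likelihood and luckiness, with the square in the mean completed. -/
theorem normalDensity_mul_luckiness (hν : 0 < ν) (hρ : 0 < ρ ^ 2) {n : ℕ}
    (x : Fin n → Fin m → ℝ) (θ : NormalParam m) :
    normalDensity θ x * luckiness ν μ₀ S₀ ρ θ =
      (2 * Real.pi) ^ (-((m : ℝ) * (n + ν) / 2)) *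
        ((θ.2 : Matrix (Fin m) (Fin m) ℝ).det ^ (-((n + ν) / 2)) *
          Real.exp (-((n + ν) / 2) * ((θ.2 : Matrix (Fin m) (Fin m) ℝ)⁻¹ *
            mapCov ν μ₀ S₀ ρ x).trace)) *
        Real.exp (-((n + ρ ^ 2 * ν) / 2) * ((θ.1 - mapMean ν μ₀ ρ x) ⬝ᵥ
          ((θ.2 : Matrix (Fin m) (Fin m) ℝ)⁻¹ *ᵥ (θ.1 - mapMean ν μ₀ ρ x)))) := by
  obtain ⟨μ, S, hS⟩ := θ
  have hd := hS.det_pos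
  have hsc := congrArg (fun M => (S⁻¹ * M).trace) (scatter_eq μ₀ S₀ hν hρ x μ)
  simp only [Matrix.mul_add, Matrix.trace_add, Matrix.mul_sum, Matrix.trace_sum,
    Matrix.mul_smul, Matrix.trace_smul, trace_mul_vecMulVec, smul_eq_mul] at hsc
  simp only [normalDensity, luckiness, Matrix.mul_add, Matrix.trace_add, Matrix.mul_smul,
    Matrix.trace_smul, trace_mul_vecMulVec, smul_eq_mul]
  have e1 : (2 * Real.pi) ^ (-((m : ℝ) * (n + ν) / 2)) =
      (2 * Real.pi) ^ (-((m : ℝ) * n / 2)) * (2 * Real.pi) ^ (-((m : ℝ) * ν / 2)) := by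
    rw [← Real.rpow_add (by positivity)]; congr 1; ring
  have e2 : S.det ^ (-((n + ν) / 2)) = S.det ^ (-((n : ℝ) / 2)) * S.det ^ (-(ν / 2)) := by
    rw [← Real.rpow_add hd]; congr 1; ring
  have hp : (0 : ℝ) < 2 * Real.pi := by positivity
  have e0 : ∀ a b : ℝ, 1 / (a * b) = a⁻¹ * b⁻¹ := by intros; rw [one_div, mul_inv]
  rw [e1, e2, mul_assoc _ _ (Real.exp _), mul_assoc _ (Real.exp _) (Real.exp _), ← Real.exp_add,
    e0, e0, ← Real.rpow_neg hp.le, ← Real.rpow_neg hp.le, ← Real.rpow_neg hd.le, ← Real.rpow_neg hd.le]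
  have e3 : ∀ a b : ℝ, -((n + ν) / 2) * a + -((n + ρ ^ 2 * ν) / 2) * b =
    -(1 / 2) * ((n + ν) * a + (n + ρ ^ 2 * ν) * b) := by intros; ring
  rw [e3, ← hsc, mul_add (-(1 / 2) : ℝ), Real.exp_add]
  have e4 : ∀ a : ℝ, -(ν / 2) * a = -(1 / 2) * (ν * a) := by intros; ring
  rw [e4]
  ring

/-- The value of the maximized product of likelihood and luckiness. -/
noncomputable def maxValue {m : ℕ} (ν : ℝ) (n : ℕ) (S : Matrix (Fin m) (Fin m) ℝ) : ℝ :=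
  (2 * Real.pi) ^ (-((m : ℝ) * (n + ν) / 2)) *
    (S.det ^ (-((n + ν) / 2)) * Real.exp (-((n + ν) / 2) * m))

/-- The maximum a posteriori parameter. -/
noncomputable def mapParam (hν : 0 < ν) (hρ : 0 < ρ ^ 2) (hS₀ : S₀.PosDef) {n : ℕ}
    (x : Fin n → Fin m → ℝ) : NormalParam m :=
  (mapMean ν μ₀ ρ x, ⟨mapCov ν μ₀ S₀ ρ x, posDef_mapCov μ₀ S₀ hν hρ hS₀ x⟩)

theorem normalDensity_mul_luckiness_mapParam (hν : 0 < ν) (hρ : 0 < ρ ^ 2) (hS₀ : S₀.PosDef)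
    {n : ℕ} (x : Fin n → Fin m → ℝ) :
    normalDensity (mapParam μ₀ S₀ hν hρ hS₀ x) x *
        luckiness ν μ₀ S₀ ρ (mapParam μ₀ S₀ hν hρ hS₀ x) =
      maxValue ν n (mapCov ν μ₀ S₀ ρ x) := by
  rw [normalDensity_mul_luckiness μ₀ S₀ hν hρ]
  have hd := (posDef_mapCov μ₀ S₀ hν hρ hS₀ x).det_pos
  simp [mapParam, maxValue, Matrix.nonsing_inv_mul _ hd.ne'.isUnit]

theorem normalDensity_mul_luckiness_le (hν : 0 < ν) (hρ : 0 < ρ ^ 2) (hS₀ : S₀.PosDef) {n : ℕ}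
    (x : Fin n → Fin m → ℝ) (θ : NormalParam m) :
    normalDensity θ x * luckiness ν μ₀ S₀ ρ θ ≤ maxValue ν n (mapCov ν μ₀ S₀ ρ x) := by
  rw [normalDensity_mul_luckiness μ₀ S₀ hν hρ]
  have hθ := θ.2.2.det_pos
  have hA := posDef_mapCov μ₀ S₀ hν hρ hS₀ x
  have hAd := hA.det_pos
  have h1 := det_rpow_mul_exp_trace_le θ.2.2 hA (N := n + ν) (by positivity)
  have h2 := dotProduct_mulVec_nonneg θ.2.2.inv (θ.1 - mapMean ν μ₀ ρ x)
  refine (mul_le_of_le_one_right (by positivity) ?_).trans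
    (mul_le_mul_of_nonneg_left h1 (by positivity))
  rw [Real.exp_le_one_iff]
  exact mul_nonpos_of_nonpos_of_nonneg (by simp only [Left.neg_nonpos_iff]; positivity) h2

theorem maxLikelihood_eq (hν : 0 < ν) (hρ : 0 < ρ ^ 2) (hS₀ : S₀.PosDef) {n : ℕ}
    (x : Fin n → Fin m → ℝ) :
    maxLikelihood normalDensity (luckiness ν μ₀ S₀ ρ) x = maxValue ν n (mapCov ν μ₀ S₀ ρ x) := by
  have : Nonempty (NormalParam m) := ⟨mapParam μ₀ S₀ hν hρ hS₀ x⟩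
  refine IsLUB.ciSup_eq (IsGreatest.isLUB
    ⟨⟨_, normalDensity_mul_luckiness_mapParam μ₀ S₀ hν hρ hS₀ x⟩, ?_⟩)
  rintro _ ⟨θ, rfl⟩
  exact normalDensity_mul_luckiness_le μ₀ S₀ hν hρ hS₀ x θ

end MapEstimates

/-! ### Normalization of the multivariate t density -/

section StudentT

variable {m : ℕ}

theorem lintegral_exp_neg_mul_dotProduct_self {s : ℝ} (hs : 0 < s) :
    ∫⁻ y : Fin m → ℝ, ENNReal.ofReal (Real.exp (-s * (y ⬝ᵥ y))) =
      ENNReal.ofReal ((Real.pi / s) ^ ((m : ℝ) / 2)) := by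
  have h : ∀ y : Fin m → ℝ, Real.exp (-s * (y ⬝ᵥ y)) = ∏ i, Real.exp (-s * y i ^ 2) := by
    intro y
    rw [← Real.exp_sum, dotProduct, Finset.mul_sum]
    simp only [pow_two]
  have hint : Integrable (fun y : Fin m → ℝ => ∏ i, Real.exp (-s * y i ^ 2)) :=
    Integrable.fintype_prod (f := fun (_ : Fin m) (t : ℝ) => Real.exp (-s * t ^ 2))
      fun _ => integrable_exp_neg_mul_sq hs
  simp_rw [h]
  rw [← ofReal_integral_eq_lintegral_ofReal hint
    (Filter.Eventually.of_forall fun y => Finset.prod_nonneg fun i _ => (Real.exp_pos _).le),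
    integral_fintype_prod_volume_eq_prod (fun (_ : Fin m) (t : ℝ) => Real.exp (-s * t ^ 2))]
  simp only [integral_gaussian, Finset.prod_const, Finset.card_univ, Fintype.card_fin]
  rw [Real.sqrt_eq_rpow, ← Real.rpow_natCast, ← Real.rpow_mul (by positivity)]
  congr 2
  ring

theorem lintegral_rpow_mul_exp_neg_mul {a r : ℝ} (ha : 0 < a) (hr : 0 < r) :
    ∫⁻ s in Set.Ioi (0 : ℝ), ENNReal.ofReal (s ^ (a - 1) * Real.exp (-(r * s))) =
      ENNReal.ofReal (Real.Gamma a * r ^ (-a)) := by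
  have hI := Real.integral_rpow_mul_exp_neg_mul_Ioi ha hr
  have hpos : (1 / r) ^ a * Real.Gamma a ≠ 0 := by
    have := Real.Gamma_pos_of_pos ha
    positivity
  -- The integral of a non-integrable function is zero by convention, so a nonzero value forces
  -- integrability.
  have hint : IntegrableOn (fun s : ℝ => s ^ (a - 1) * Real.exp (-(r * s))) (Set.Ioi 0) := by
    by_contra hcon
    rw [integral_undef hcon] at hI
    exact hpos hI.symm
  rw [← ofReal_integral_eq_lintegral_ofReal hint, hI, one_div, Real.inv_rpow hr.le,
    Real.rpow_neg hr.le, mul_comm]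
  filter_upwards [ae_restrict_mem measurableSet_Ioi] with s hs
  exact mul_nonneg (Real.rpow_nonneg (le_of_lt hs) _) (Real.exp_pos _).le

/-- The t density is a Gamma mixture of Gaussians: write the power as a Gamma integral in `s`,
exchange the integrals by Tonelli, and integrate first the Gaussian in `y`, then the Gamma integrand
left in `s`. -/
theorem lintegral_standard_t {d : ℝ} (hd : 0 < d) :
    ∫⁻ y : Fin m → ℝ, ENNReal.ofReal (Real.Gamma ((d + m) / 2) *
        (1 + 1 / d * (y ⬝ᵥ y)) ^ (-((d + m) / 2))) =
      ENNReal.ofReal (Real.Gamma (d / 2) * (d * Real.pi) ^ ((m : ℝ) / 2)) := by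
  have hnn : ∀ y : Fin m → ℝ, 0 ≤ y ⬝ᵥ y := fun y =>
    Finset.sum_nonneg fun i _ => mul_self_nonneg (y i)
  have hdot : Measurable fun y : Fin m → ℝ => y ⬝ᵥ y := by
    unfold dotProduct; fun_prop
  calc _ = ∫⁻ y : Fin m → ℝ, ∫⁻ s in Set.Ioi (0 : ℝ),
        ENNReal.ofReal (s ^ ((d + m) / 2 - 1) * Real.exp (-((1 + 1 / d * (y ⬝ᵥ y)) * s))) := by
        refine lintegral_congr fun y => ?_
        have := hnn y
        rw [lintegral_rpow_mul_exp_neg_mul (by positivity) (by positivity)]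
    _ = ∫⁻ s in Set.Ioi (0 : ℝ), ∫⁻ y : Fin m → ℝ,
        ENNReal.ofReal (s ^ ((d + m) / 2 - 1) * Real.exp (-((1 + 1 / d * (y ⬝ᵥ y)) * s))) := by
        refine lintegral_lintegral_swap (Measurable.aemeasurable ?_)
        simp only [Function.uncurry_def]
        have : Measurable fun p : (Fin m → ℝ) × ℝ => p.1 ⬝ᵥ p.1 := hdot.comp measurable_fst
        fun_prop
    _ = ∫⁻ s in Set.Ioi (0 : ℝ), ENNReal.ofReal ((d * Real.pi) ^ ((m : ℝ) / 2)) *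
        ENNReal.ofReal (s ^ (d / 2 - 1) * Real.exp (-(1 * s))) := by
        refine setLIntegral_congr_fun measurableSet_Ioi fun s hs => ?_
        have hs : 0 < s := hs
        have e : ∀ y : Fin m → ℝ, ENNReal.ofReal (s ^ ((d + m) / 2 - 1) *
            Real.exp (-((1 + 1 / d * (y ⬝ᵥ y)) * s))) =
            ENNReal.ofReal (s ^ ((d + m) / 2 - 1) * Real.exp (-s)) *
              ENNReal.ofReal (Real.exp (-(s / d) * (y ⬝ᵥ y))) := by
          intro y
          rw [← ENNReal.ofReal_mul (by positivity), mul_assoc, ← Real.exp_add]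
          congr 3
          ring
        simp_rw [e]
        rw [lintegral_const_mul _ (by fun_prop), lintegral_exp_neg_mul_dotProduct_self
          (by positivity), ← ENNReal.ofReal_mul (by positivity),
          ← ENNReal.ofReal_mul (by positivity)]
        congr 1
        rw [show Real.pi / (s / d) = d * Real.pi * s⁻¹ by field_simp,
          Real.mul_rpow (by positivity) (by positivity), Real.inv_rpow hs.le,
          ← Real.rpow_neg hs.le, show (d + m) / 2 - 1 = (d / 2 - 1) + (m : ℝ) / 2 by ring,
          Real.rpow_add hs, one_mul]
        have : s ^ ((m : ℝ) / 2) * s ^ (-((m : ℝ) / 2)) = 1 := by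
          rw [← Real.rpow_add hs]; simp
        linear_combination (s ^ (d / 2 - 1) * Real.exp (-s) * (d * Real.pi) ^ ((m : ℝ) / 2)) * this
    _ = _ := by
        rw [lintegral_const_mul _ (by fun_prop), lintegral_rpow_mul_exp_neg_mul (by positivity)
          one_pos, ← ENNReal.ofReal_mul (by positivity), Real.one_rpow, mul_one, mul_comm]

theorem lintegral_comp_mulVec {B : Matrix (Fin m) (Fin m) ℝ} (hB : B.det ≠ 0)
    {f : (Fin m → ℝ) → ENNReal} (hf : Measurable f) :
    ∫⁻ y, f (B *ᵥ y) = ENNReal.ofReal |B.det⁻¹| * ∫⁻ y, f y := by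
  have h := lintegral_map (μ := volume) hf
    (LinearMap.continuous_of_finiteDimensional (Matrix.toLin' B)).measurable
  rw [Real.map_matrix_volume_pi_eq_smul_volume_pi hB, lintegral_smul_measure] at h
  simpa using h.symm

theorem tDensity_nonneg {d : ℝ} (hd : 0 < d) (μ : Fin m → ℝ) {S : Matrix (Fin m) (Fin m) ℝ}
    (hS : S.PosDef) (y : Fin m → ℝ) : 0 ≤ tDensity d μ S y := by
  have h1 := hS.det_pos
  have h2 := dotProduct_mulVec_nonneg hS.inv (y - μ)
  have h3 := Real.Gamma_pos_of_pos (s := (d + m) / 2) (by positivity)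
  have h4 := Real.Gamma_pos_of_pos (s := d / 2) (by positivity)
  unfold tDensity
  positivity

/-- The multivariate t density integrates to one. -/
theorem lintegral_tDensity {d : ℝ} (hd : 0 < d) (μ : Fin m → ℝ) {S : Matrix (Fin m) (Fin m) ℝ}
    (hS : S.PosDef) : ∫⁻ y, ENNReal.ofReal (tDensity d μ S y) = 1 := by
  -- The substitution `y ↦ B *ᵥ (y - μ)` reduces to the standard density; its Jacobian cancels the
  -- determinant factor.
  obtain ⟨B, hB0, hB⟩ := exists_transpose_mul_self hS.inv
  have hSd := hS.det_pos
  have hG := Real.Gamma_pos_of_pos (s := d / 2) (by positivity)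
  have hdet : S.det ^ ((1 : ℝ) / 2) = |B.det|⁻¹ := by
    have h1 : (S⁻¹).det = S.det⁻¹ := by rw [Matrix.det_nonsing_inv, Ring.inverse_eq_inv']
    rw [hB, Matrix.det_mul, Matrix.det_transpose] at h1
    rw [← Real.sqrt_eq_rpow, show S.det = |B.det|⁻¹ ^ 2 by
      rw [inv_pow, sq_abs, pow_two, h1, inv_inv]]
    exact Real.sqrt_sq (by positivity)
  set c : ℝ := Real.Gamma (d / 2) * (d * Real.pi) ^ ((m : ℝ) / 2) with hc
  have hc0 : 0 < c := by positivity
  let f : (Fin m → ℝ) → ENNReal := fun y => ENNReal.ofReal (Real.Gamma ((d + m) / 2) *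
        (1 + 1 / d * (y ⬝ᵥ y)) ^ (-((d + m) / 2)))
  have hf : Measurable f := by
    have : Measurable fun y : Fin m → ℝ => y ⬝ᵥ y := by unfold dotProduct; fun_prop
    fun_prop
  have e : ∀ y, ENNReal.ofReal (tDensity d μ S y) =
      ENNReal.ofReal (|B.det| / c) * f (B *ᵥ (y - μ)) := by
    intro y
    rw [← ENNReal.ofReal_mul (by positivity)]
    congr 1
    rw [tDensity, hdet, hB, dotProduct_transpose_mul_self_mulVec, ← hc]
    have : |B.det| ≠ 0 := abs_ne_zero.2 hB0
    field_simp
  simp_rw [e]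
  have hcomp : Measurable fun y : Fin m → ℝ => f (B *ᵥ y) := hf.comp
    (LinearMap.continuous_of_finiteDimensional (Matrix.toLin' B)).measurable
  have hsub : Measurable fun y : Fin m → ℝ => f (B *ᵥ (y - μ)) :=
    hcomp.comp (measurable_id.sub_const μ)
  rw [lintegral_const_mul _ hsub,
    lintegral_sub_right_eq_self (fun y => f (B *ᵥ y)) μ, lintegral_comp_mulVec hB0 hf,
    lintegral_standard_t hd, ← hc, ← ENNReal.ofReal_mul (by positivity),
    ← ENNReal.ofReal_mul (by positivity), ENNReal.ofReal_eq_one, abs_inv]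
  have : |B.det| ≠ 0 := abs_ne_zero.2 hB0
  field_simp

end StudentT

/-! ### Processes built from conditional densities, and exchangeability -/

section SequentialProcess

open ProbabilityTheory Finset

variable {E : Type*}

/-- Every finite set of times lies in a long initial segment, and projective limits of finite
measures are unique. Requiring only `n ≥ N` lets a finitary permutation act inside the segment. -/
theorem ext_of_map_initial [MeasurableSpace E] {P Q : Measure (ℕ → E)} [IsFiniteMeasure P] (N : ℕ)
    (h : ∀ n, N ≤ n → Q.map (fun ω (i : Fin n) => ω i) = P.map (fun ω (i : Fin n) => ω i)) :
    Q = P := by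
  have hP : IsProjectiveLimit P fun I : Finset ℕ => P.map I.restrict := fun _ => rfl
  refine IsProjectiveLimit.unique (P := fun I : Finset ℕ => P.map I.restrict) (fun I => ?_) hP
  have hlt : ∀ i : I, (i : ℕ) < max N (I.sup id + 1) := fun i =>
    lt_max_of_lt_right (Nat.lt_succ_of_le (Finset.le_sup (f := id) i.2))
  let g : (Fin (max N (I.sup id + 1)) → E) → (I → E) := fun x i => x ⟨i, hlt i⟩
  have hg : Measurable g := by fun_prop
  have hcomp : (I.restrict : (ℕ → E) → (I → E)) =
      g ∘ fun ω (i : Fin (max N (I.sup id + 1))) => ω i := rfl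
  have hm : Measurable fun (ω : ℕ → E) (i : Fin (max N (I.sup id + 1))) => ω i := by fun_prop
  change Measure.map I.restrict Q = Measure.map I.restrict P
  rw [hcomp, ← Measure.map_map hg hm, ← Measure.map_map hg hm, h _ (le_max_left _ _)]

theorem measurable_snoc [MeasurableSpace E] {n : ℕ} :
    Measurable fun p : (Fin n → E) × E => (Fin.snoc p.1 p.2 : Fin (n + 1) → E) := by
  refine measurable_pi_lambda _ fun i => ?_
  refine Fin.lastCases ?_ (fun j => ?_) i
  · simpa using measurable_snd
  · simp only [Fin.snoc_castSucc]; fun_prop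

variable [MeasureSpace E] [SigmaFinite (volume : Measure E)]

theorem lintegral_eq_lintegral_lintegral_snoc {n : ℕ} {f : (Fin (n + 1) → E) → ENNReal}
    (hf : Measurable f) :
    ∫⁻ x, f x = ∫⁻ z : Fin n → E, ∫⁻ y : E, f (Fin.snoc z y) := by
  have h := (volume_preserving_piFinSuccAbove (fun _ : Fin (n + 1) => E) (Fin.last n)).symm
  rw [← h.lintegral_comp hf, Measure.volume_eq_prod, lintegral_prod_symm]
  · simp [MeasurableEquiv.piFinSuccAbove_symm_apply, Fin.snocEquiv]
  · exact (hf.comp (MeasurableEquiv.measurable _)).aemeasurable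

/-- Sequential conditional densities with respect to a reference measure are the conditional
densities of a stochastic process. -/
theorem exists_process [Nonempty E] (p : (n : ℕ) → (Fin n → E) → ENNReal)
    (q : (n : ℕ) → (Fin n → E) → E → ENNReal)
    (hp : ∀ n, Measurable (p n)) (hq : ∀ n, Measurable (Function.uncurry (q n)))
    (hq1 : ∀ n z, ∫⁻ y, q n z y = 1) (hp0 : ∀ x, p 0 x = 1)
    (hpq : ∀ n z y, p (n + 1) (Fin.snoc z y) = p n z * q n z y) :
    ∃ P : Measure (ℕ → E), IsProbabilityMeasure P ∧
      ∀ n : ℕ, P.map (fun ω (i : Fin n) => ω i) = volume.withDensity (p n) := by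
  -- the reference point `e` occupies time `0` of an auxiliary process, the observations come after
  obtain ⟨e⟩ := ‹Nonempty E›
  let r : (n : ℕ) → (Iic n → E) → Fin n → E := fun n x j => x ⟨j + 1, mem_Iic.2 j.2⟩
  have hr : ∀ n, Measurable (r n) := fun n => by fun_prop
  let κ : (n : ℕ) → Kernel (Iic n → E) E := fun n =>
    (Kernel.const (Iic n → E) (volume : Measure E)).withDensity fun x y => q n (r n x) y
  have hqr : ∀ n, Measurable (Function.uncurry fun (x : Iic n → E) y => q n (r n x) y) := fun n =>
    (hq n).comp (((hr n).comp measurable_fst).prodMk measurable_snd)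
  have hκ : ∀ n x, κ n x = volume.withDensity fun y => q n (r n x) y := fun n x => by
    simp only [κ]
    rw [Kernel.withDensity_apply _ (hqr n), Kernel.const_apply]
  have hM : ∀ n, IsMarkovKernel (κ n) := fun n => ⟨fun x => ⟨by
    rw [hκ, withDensity_apply _ .univ, Measure.restrict_univ, hq1]⟩⟩
  let ξ : Measure (ℕ → E) := Kernel.traj (X := fun _ => E) κ 0 fun _ => e
  have hξ : IsProbabilityMeasure ξ := inferInstanceAs
    (IsProbabilityMeasure (Kernel.traj (X := fun _ => E) κ 0 fun _ => e))
  have hshift : Measurable fun (ω : ℕ → E) i => ω (i + 1) := by fun_prop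
  have hPr : IsProbabilityMeasure (ξ.map fun (ω : ℕ → E) i => ω (i + 1)) :=
    Measure.isProbabilityMeasure_map hshift.aemeasurable
  refine ⟨ξ.map fun ω i => ω (i + 1), hPr, fun n => ?_⟩
  induction n with
  | zero =>
    have hm : Measurable fun (ω : ℕ → E) (i : Fin 0) => ω i := by fun_prop
    have h1 := Measure.isProbabilityMeasure_map (μ := ξ.map fun ω i => ω (i + 1)) hm.aemeasurable
    -- With no observations the space is a single point of volume one.
    have h2 : volume.withDensity (p 0) = (volume : Measure (Fin 0 → E)) := by
      rw [show p 0 = 1 from funext hp0, withDensity_one]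
    rw [h2]
    ext s _
    rcases s.eq_empty_or_nonempty with rfl | hs
    · simp
    · rw [Subsingleton.eq_univ_of_nonempty hs, measure_univ, volume_pi, Measure.pi_empty_univ]
  | succ n ih =>
    have hm : ∀ k : ℕ, Measurable fun (ω : ℕ → E) (i : Fin k) => ω i := fun k => by fun_prop
    rw [Measure.map_map (hm _) hshift] at ih ⊢
    -- The joint law of the coordinates up to `n` and of coordinate `n + 1` is the composition
    -- product with `κ n`; integrating test functions against it multiplies the densities, as in
    -- `hpq`.
    have htr := Kernel.partialTraj_compProd_eq_map_traj (X := fun _ => E) (κ := κ) (Nat.zero_le n)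
      (x₀ := fun _ => e)
    rw [← Kernel.traj_map_frestrictLe_apply] at htr
    have hg : Measurable fun u : (Iic n → E) × E =>
        (Fin.snoc (r n u.1) u.2 : Fin (n + 1) → E) :=
      measurable_snoc.comp (((hr n).comp measurable_fst).prodMk measurable_snd)
    have hfr : Measurable fun ω : ℕ → E =>
        ((Preorder.frestrictLe n ω : Iic n → E), ω (n + 1)) := by fun_prop
    have hcomp : ((fun (ω : ℕ → E) (i : Fin (n + 1)) => ω i) ∘ fun (ω : ℕ → E) i => ω (i + 1)) =
        (fun u : (Iic n → E) × E => (Fin.snoc (r n u.1) u.2 : Fin (n + 1) → E)) ∘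
          fun ω : ℕ → E => ((Preorder.frestrictLe n ω : Iic n → E), ω (n + 1)) := by
      funext ω i
      refine Fin.lastCases ?_ (fun j => ?_) i
      · simp
      · simp [r]
    rw [hcomp, ← Measure.map_map hg hfr]
    change Measure.map _ (Measure.map _ (Kernel.traj (X := fun _ => E) κ 0 fun _ => e)) = _
    rw [← htr]
    refine Measure.ext_of_lintegral _ fun f hf => ?_
    have hf' : Measurable fun u : (Iic n → E) × E => f (Fin.snoc (r n u.1) u.2) := hf.comp hg
    rw [lintegral_map hf hg, Measure.lintegral_compProd hf',
      lintegral_withDensity_eq_lintegral_mul _ (hp _) hf,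
      lintegral_eq_lintegral_lintegral_snoc ((hp _).mul hf)]
    have inner : ∀ u : Iic n → E, ∫⁻ y, f (Fin.snoc (r n u) y) ∂κ n u =
        ∫⁻ y, q n (r n u) y * f (Fin.snoc (r n u) y) := by
      intro u
      have h1 : Measurable fun y => q n (r n u) y := (hq n).comp measurable_prodMk_left
      have h2 : Measurable fun y => f (Fin.snoc (r n u) y) :=
        (hf.comp measurable_snoc).comp (measurable_prodMk_left (x := r n u))
      rw [hκ, lintegral_withDensity_eq_lintegral_mul _ h1 h2]
      rfl
    have hG : Measurable fun z : Fin n → E => ∫⁻ y, q n z y * f (Fin.snoc z y) :=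
      Measurable.lintegral_prod_right ((hq n).mul (hf.comp measurable_snoc))
    have hrmap : (Measure.map (Preorder.frestrictLe n)
        (Kernel.traj (X := fun _ => E) κ 0 fun _ => e)).map (r n) = volume.withDensity (p n) := by
      rw [← ih, Measure.map_map (hr n) (by fun_prop)]
      rfl
    simp_rw [inner]
    rw [← lintegral_map hG (hr n), hrmap, lintegral_withDensity_eq_lintegral_mul _ (hp _) hG]
    refine lintegral_congr fun z => ?_
    have h1 : Measurable fun y => q n z y * f (Fin.snoc z y) :=
      ((hq n).comp measurable_prodMk_left).mul
        ((hf.comp measurable_snoc).comp (measurable_prodMk_left (x := z)))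
    simp only [Pi.mul_apply, hpq, mul_assoc]
    rw [lintegral_const_mul _ h1]

theorem map_comp_perm_withDensity {n : ℕ} {p : (Fin n → E) → ENNReal} (hp : Measurable p)
    (π : Equiv.Perm (Fin n)) (hsymm : ∀ x, p (x ∘ π) = p x) :
    (volume.withDensity p).map (fun x => x ∘ π) = volume.withDensity p := by
  have hmp : MeasurePreserving (fun x : Fin n → E => x ∘ π) := by
    have h := volume_measurePreserving_piCongrLeft (fun _ : Fin n => E) π.symm
    suffices e : (fun x : Fin n → E => x ∘ π) =
        MeasurableEquiv.piCongrLeft (fun _ : Fin n => E) π.symm by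
      rw [e]
      exact h
    funext x i
    have := Equiv.piCongrLeft_apply_apply (fun _ : Fin n => E) π.symm x (π i)
    simp only [Equiv.symm_apply_apply] at this
    exact this.symm
  refine Measure.ext_of_lintegral _ fun f hf => ?_
  have hf' : Measurable fun x : Fin n → E => f (x ∘ π) := hf.comp hmp.measurable
  rw [lintegral_map hf hmp.measurable, lintegral_withDensity_eq_lintegral_mul _ hp hf,
    lintegral_withDensity_eq_lintegral_mul _ hp hf',
    ← hmp.lintegral_comp (hp.mul hf)]
  simp [hsymm]

/-- A process whose finite-dimensional densities are symmetric is exchangeable. -/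
theorem exchangeable_of_symmetric {p : (n : ℕ) → (Fin n → E) → ENNReal}
    (hp : ∀ n, Measurable (p n)) (hsymm : ∀ n (π : Equiv.Perm (Fin n)) x, p n (x ∘ π) = p n x)
    {P : Measure (ℕ → E)} [IsFiniteMeasure P]
    (hP : ∀ n : ℕ, P.map (fun ω (i : Fin n) => ω i) = volume.withDensity (p n)) :
    Exchangeable P := by
  intro σ hσ
  obtain ⟨N, hN⟩ := hσ.bddAbove
  refine ext_of_map_initial (N + 1) fun n hn => ?_
  -- If `σ` moves `i`, it also moves `σ i`, which is then at most `N`; so `σ` preserves the segment.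
  have hlt : ∀ i : Fin n, σ i < n := by
    intro i
    by_cases h : σ i = i
    · rw [h]; exact i.2
    · have : σ (σ i) ≠ σ i := fun h' => h (σ.injective h')
      exact lt_of_lt_of_le (Nat.lt_succ_of_le (hN this)) hn
  let g : Fin n → Fin n := fun i => ⟨σ i, hlt i⟩
  have hg : Function.Injective g := fun i j h => Fin.ext (σ.injective (congrArg Fin.val h))
  let π : Equiv.Perm (Fin n) := Equiv.ofBijective g (Finite.injective_iff_bijective.1 hg)
  have hπ : Measurable fun x : Fin n → E => x ∘ π :=
    measurable_pi_lambda _ fun i => measurable_pi_apply _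
  have hcomp : ((fun (ω : ℕ → E) (i : Fin n) => ω i) ∘ fun (ω : ℕ → E) i => ω (σ i)) =
      (fun x : Fin n → E => x ∘ π) ∘ fun ω (i : Fin n) => ω i := rfl
  rw [Measure.map_map (by fun_prop) (by fun_prop), hcomp, ← Measure.map_map hπ (by fun_prop),
    hP, map_comp_perm_withDensity (hp n) π (hsymm n π)]

end SequentialProcess

/-! ### Factorization of the maximum into t densities -/

section Sequential

variable {m : ℕ} {ν : ℝ} (μ₀ : Fin m → ℝ) (S₀ : Matrix (Fin m) (Fin m) ℝ) {ρ : ℝ}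

theorem maxValue_pos {n : ℕ} {S : Matrix (Fin m) (Fin m) ℝ} (hS : S.PosDef) :
    0 < maxValue ν n S := by
  have := hS.det_pos
  unfold maxValue
  positivity

theorem tDof_pos (hν : (m : ℝ) - 1 < ν) (k : ℕ) : 0 < tDof m ν (k + 1) := by
  unfold tDof
  push_cast
  linarith [(Nat.cast_nonneg k : (0 : ℝ) ≤ k)]

theorem scaleFactor_pos (hν₀ : 0 < ν) (hν : (m : ℝ) - 1 < ν) (hρ : 0 < ρ ^ 2) (k : ℕ) :
    0 < scaleFactor m ν ρ (k + 1) := by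
  have h := tDof_pos hν k
  unfold tDof at h
  unfold scaleFactor
  have h1 : (0 : ℝ) < ν + (k + 1 : ℕ) - 1 := by push_cast; ring_nf; positivity
  have h2 : (0 : ℝ) < ρ ^ 2 * ν + (k + 1 : ℕ) - 1 := by push_cast; ring_nf; positivity
  positivity

theorem posDef_scaleFactor_smul_mapCov (hν₀ : 0 < ν) (hν : (m : ℝ) - 1 < ν) (hρ : 0 < ρ ^ 2)
    (hS₀ : S₀.PosDef) {k : ℕ} (z : Fin k → Fin m → ℝ) :
    (scaleFactor m ν ρ (k + 1) • mapCov ν μ₀ S₀ ρ z).PosDef :=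
  (posDef_mapCov μ₀ S₀ hν₀ hρ hS₀ z).smul (scaleFactor_pos hν₀ hν hρ k)

theorem predictiveDensity_nonneg (hν₀ : 0 < ν) (hν : (m : ℝ) - 1 < ν) (hρ : 0 < ρ ^ 2)
    (hS₀ : S₀.PosDef) {k : ℕ} (z : Fin k → Fin m → ℝ) (y : Fin m → ℝ) :
    0 ≤ predictiveDensity ν μ₀ S₀ ρ z y :=
  tDensity_nonneg (tDof_pos hν k) _ (posDef_scaleFactor_smul_mapCov μ₀ S₀ hν₀ hν hρ hS₀ z) y

/-- Appending an observation multiplies the maximum by the predictive density, up to a constant. -/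
theorem exists_maxValue_snoc (hν₀ : 0 < ν) (hν : (m : ℝ) - 1 < ν) (hρ : 0 < ρ ^ 2)
    (hS₀ : S₀.PosDef) (n : ℕ) :
    ∃ K : ℝ, 0 < K ∧ ∀ (z : Fin n → Fin m → ℝ) (y : Fin m → ℝ),
      maxValue ν (n + 1) (mapCov ν μ₀ S₀ ρ (Fin.snoc z y : Fin (n + 1) → Fin m → ℝ)) =
        K * (maxValue ν n (mapCov ν μ₀ S₀ ρ z) * predictiveDensity ν μ₀ S₀ ρ z y) := by
  have hd := tDof_pos hν n
  have hc := scaleFactor_pos hν₀ hν hρ n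
  set d := tDof m ν (n + 1) with hd_def
  set c := scaleFactor m ν ρ (n + 1) with hc_def
  -- The degrees of freedom are such that the exponent of the t density is that of the maximum for
  -- `n + 1` observations.
  have hdm : d + m = n + 1 + ν := by rw [hd_def, tDof]; push_cast; ring
  have hΓ₁ := Real.Gamma_pos_of_pos (s := (d + m) / 2) (by positivity)
  have hΓ₂ := Real.Gamma_pos_of_pos (s := d / 2) (by positivity)
  set a₁ := (2 * Real.pi) ^ (-((m : ℝ) * ((n + 1 : ℕ) + ν) / 2)) *
    Real.exp (-(((n + 1 : ℕ) + ν) / 2) * m) with ha₁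
  set a₀ := (2 * Real.pi) ^ (-((m : ℝ) * (n + ν) / 2)) * Real.exp (-((n + ν) / 2) * m) with ha₀
  have ha₁p : 0 < a₁ := by positivity
  have ha₀p : 0 < a₀ := by positivity
  set r : ℝ := ((n + ν) / (n + 1 + ν)) ^ m with hr
  have hrp : 0 < r := by positivity
  set P : ℝ := (d * Real.pi) ^ ((m : ℝ) / 2) with hP
  have hPp : 0 < P := by positivity
  -- The witness collects all factors free of `z` and `y`.
  refine ⟨a₁ / a₀ * r ^ (-((n + 1 + ν) / 2)) *
    (Real.Gamma (d / 2) * P * (c ^ m) ^ ((1 : ℝ) / 2) / Real.Gamma ((d + m) / 2)),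
    by positivity, fun z y => ?_⟩
  have hS := posDef_mapCov μ₀ S₀ hν₀ hρ hS₀ z
  have hD := hS.det_pos
  rw [mapCov_snoc μ₀ S₀ hν₀ hρ, predictiveDensity, ← hd_def, ← hc_def]
  set S := mapCov ν μ₀ S₀ ρ z with hS_def
  set v := y - mapMean ν μ₀ ρ z with hv
  set k : ℝ := (n + ρ ^ 2 * ν) / ((n + 1 + ρ ^ 2 * ν) * (n + ν)) with hk
  have hkp : 0 < k := by positivity
  have hq := dotProduct_mulVec_nonneg hS.inv v
  -- The scale factor is chosen so that `c * d * k = 1`.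
  have hinv : 1 / d * (v ⬝ᵥ ((c • S)⁻¹ *ᵥ v)) = k * (v ⬝ᵥ (S⁻¹ *ᵥ v)) := by
    have := invertibleOfNonzero hc.ne'
    rw [Matrix.inv_smul _ _ hD.ne'.isUnit, invOf_eq_inv, Matrix.smul_mulVec, dotProduct_smul,
      smul_eq_mul, ← mul_assoc]
    congr 1
    have hd0 := hd.ne'
    rw [hc_def, scaleFactor, hk]
    rw [hd_def, tDof] at hd0 ⊢
    push_cast at hd0 ⊢
    have h1 : (n + ν : ℝ) ≠ 0 := by positivity
    have h3 : (n + ρ ^ 2 * ν : ℝ) ≠ 0 := by positivity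
    have h4 : (n + 1 + ρ ^ 2 * ν : ℝ) ≠ 0 := by positivity
    rw [show ρ ^ 2 * ν + ((n : ℝ) + 1) - 1 = n + ρ ^ 2 * ν by ring,
      show ν + ((n : ℝ) + 1) - 1 = n + ν by ring,
      show ρ ^ 2 * ν + ((n : ℝ) + 1) = n + 1 + ρ ^ 2 * ν by ring]
    field_simp
  set t : ℝ := 1 + k * (v ⬝ᵥ (S⁻¹ *ᵥ v)) with ht
  have htp : 0 < t := by positivity
  have hdet : (((n + ν : ℝ) / (n + 1 + ν)) • (S + k • Matrix.vecMulVec v v)).det =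
      r * (S.det * t) := by
    rw [Matrix.det_smul, Fintype.card_fin, det_add_smul_vecMulVec hD.ne']
  -- The extra half power of the determinant is the one in the normalization of the t density.
  have hDpow : S.det ^ (-((n + 1 + ν) / 2)) =
      S.det ^ (-((n + ν) / 2)) * (S.det ^ ((1 : ℝ) / 2))⁻¹ := by
    rw [← Real.rpow_neg hD.le, ← Real.rpow_add hD]
    congr 1
    ring
  have hL : maxValue ν (n + 1) (((n + ν : ℝ) / (n + 1 + ν)) • (S + k • Matrix.vecMulVec v v)) =
      a₁ * (r ^ (-((n + 1 + ν) / 2)) *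
        (S.det ^ (-((n + ν) / 2)) * (S.det ^ ((1 : ℝ) / 2))⁻¹ * t ^ (-((n + 1 + ν) / 2)))) := by
    rw [maxValue, hdet, ha₁, ← hDpow, ← Real.mul_rpow hD.le htp.le,
      ← Real.mul_rpow hrp.le (by positivity)]
    push_cast
    ring
  have hM : maxValue ν n S = a₀ * S.det ^ (-((n + ν) / 2)) := by
    rw [maxValue, ha₀]; ring
  have hT : tDensity d (mapMean ν μ₀ ρ z) (c • S) y = Real.Gamma ((d + m) / 2) /
      (Real.Gamma (d / 2) * P * ((c ^ m) ^ ((1 : ℝ) / 2) * S.det ^ ((1 : ℝ) / 2))) *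
        t ^ (-((n + 1 + ν) / 2)) := by
    rw [tDensity, ← hv, hinv, Matrix.det_smul, Fintype.card_fin,
      Real.mul_rpow (by positivity) hD.le, ← ht, ← hP, hdm]
  rw [hL, hM, hT]
  have hD2 : 0 < S.det ^ ((1 : ℝ) / 2) := by positivity
  have hc2 : 0 < (c ^ m) ^ ((1 : ℝ) / 2) := by positivity
  generalize S.det ^ ((1 : ℝ) / 2) = D₂ at *
  generalize (c ^ m) ^ ((1 : ℝ) / 2) = c₂ at *
  generalize t ^ (-((n + 1 + ν) / 2)) = t₂ at *
  generalize r ^ (-((n + 1 + ν) / 2)) = r₂ at *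
  generalize S.det ^ (-((n + ν) / 2)) = s₂ at *
  field_simp

/-- The product of the predictive densities along a sample. -/
noncomputable def predictiveProduct (ν : ℝ) (μ₀ : Fin m → ℝ) (S₀ : Matrix (Fin m) (Fin m) ℝ)
    (ρ : ℝ) (n : ℕ) (x : Fin n → Fin m → ℝ) : ℝ :=
  ∏ i : Fin n, predictiveDensity ν μ₀ S₀ ρ (Fin.take i i.isLt.le x) (x i)

theorem predictiveProduct_snoc (n : ℕ) (z : Fin n → Fin m → ℝ) (y : Fin m → ℝ) :
    predictiveProduct ν μ₀ S₀ ρ (n + 1) (Fin.snoc z y) =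
      predictiveProduct ν μ₀ S₀ ρ n z * predictiveDensity ν μ₀ S₀ ρ z y := by
  have htake : ∀ (k : ℕ) (h : k ≤ n) (h' : k ≤ n + 1),
      Fin.take k h' (Fin.snoc z y : Fin (n + 1) → Fin m → ℝ) = Fin.take k h z := by
    intro k h h'
    funext j
    exact Fin.snoc_castSucc (α := fun _ => Fin m → ℝ) y z (Fin.castLE h j)
  rw [predictiveProduct, Fin.prod_univ_castSucc, Fin.snoc_last]
  congr 1
  · refine Finset.prod_congr rfl fun i _ => ?_
    rw [Fin.snoc_castSucc]
    exact congrArg (fun w => predictiveDensity ν μ₀ S₀ ρ w (z i)) (htake i i.isLt.le _)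
  · exact congrArg (fun w => predictiveDensity ν μ₀ S₀ ρ w y) (htake n le_rfl _)

theorem predictiveProduct_nonneg (hν₀ : 0 < ν) (hν : (m : ℝ) - 1 < ν) (hρ : 0 < ρ ^ 2)
    (hS₀ : S₀.PosDef) (n : ℕ) (x : Fin n → Fin m → ℝ) :
    0 ≤ predictiveProduct ν μ₀ S₀ ρ n x :=
  Finset.prod_nonneg fun _ _ => predictiveDensity_nonneg μ₀ S₀ hν₀ hν hρ hS₀ _ _

theorem exists_maxValue_eq_mul_predictiveProduct (hν₀ : 0 < ν) (hν : (m : ℝ) - 1 < ν)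
    (hρ : 0 < ρ ^ 2) (hS₀ : S₀.PosDef) (n : ℕ) :
    ∃ C : ℝ, 0 < C ∧ ∀ x : Fin n → Fin m → ℝ,
      maxValue ν n (mapCov ν μ₀ S₀ ρ x) = C * predictiveProduct ν μ₀ S₀ ρ n x := by
  induction n with
  | zero =>
    refine ⟨maxValue ν 0 (mapCov ν μ₀ S₀ ρ Fin.elim0),
      maxValue_pos (posDef_mapCov μ₀ S₀ hν₀ hρ hS₀ _), fun x => ?_⟩
    rw [Subsingleton.elim x Fin.elim0]
    simp [predictiveProduct]
  | succ n ih =>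
    obtain ⟨C, hC, h⟩ := ih
    obtain ⟨K, hK, hK'⟩ := exists_maxValue_snoc μ₀ S₀ hν₀ hν hρ hS₀ n
    refine ⟨K * C, by positivity, fun x => ?_⟩
    rw [← Fin.snoc_init_self x, hK', h, predictiveProduct_snoc]
    ring

theorem measurable_maxValue_mapCov (n : ℕ) :
    Measurable fun x : Fin n → Fin m → ℝ => maxValue ν n (mapCov ν μ₀ S₀ ρ x) := by
  have hc : Continuous fun x : Fin n → Fin m → ℝ => mapCov ν μ₀ S₀ ρ x := by
    refine continuous_matrix fun a b => ?_
    simp only [mapCov_apply]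
    fun_prop
  have hdet := hc.matrix_det.measurable
  unfold maxValue
  fun_prop

theorem measurable_predictiveProduct (hν₀ : 0 < ν) (hν : (m : ℝ) - 1 < ν)
    (hρ : 0 < ρ ^ 2) (hS₀ : S₀.PosDef) (n : ℕ) :
    Measurable (predictiveProduct ν μ₀ S₀ ρ n) := by
  obtain ⟨C, hC, h⟩ := exists_maxValue_eq_mul_predictiveProduct μ₀ S₀ hν₀ hν hρ hS₀ n
  have e : predictiveProduct ν μ₀ S₀ ρ n =
      fun x => C⁻¹ * maxValue ν n (mapCov ν μ₀ S₀ ρ x) := by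
    funext x
    rw [h]
    field_simp
  rw [e]
  exact (measurable_maxValue_mapCov μ₀ S₀ n).const_mul _

/-- As a ratio of consecutive maxima, the factor involves determinants of `mapCov` but no matrix
inverse, so measurability follows from continuity of its entries. -/
theorem measurable_predictiveDensity (hν₀ : 0 < ν) (hν : (m : ℝ) - 1 < ν)
    (hρ : 0 < ρ ^ 2) (hS₀ : S₀.PosDef) (n : ℕ) :
    Measurable fun p : (Fin n → Fin m → ℝ) × (Fin m → ℝ) =>
      predictiveDensity ν μ₀ S₀ ρ p.1 p.2 := by
  obtain ⟨K, hK, h⟩ := exists_maxValue_snoc μ₀ S₀ hν₀ hν hρ hS₀ n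
  have e : (fun p : (Fin n → Fin m → ℝ) × (Fin m → ℝ) => predictiveDensity ν μ₀ S₀ ρ p.1 p.2) =
      fun p => maxValue ν (n + 1)
          (mapCov ν μ₀ S₀ ρ (Fin.snoc p.1 p.2 : Fin (n + 1) → Fin m → ℝ)) /
        (K * maxValue ν n (mapCov ν μ₀ S₀ ρ p.1)) := by
    funext p
    have := (maxValue_pos (ν := ν) (n := n) (posDef_mapCov μ₀ S₀ hν₀ hρ hS₀ p.1)).ne'
    rw [h]
    field_simp
  rw [e]
  exact ((measurable_maxValue_mapCov μ₀ S₀ (n + 1)).comp measurable_snoc).div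
    (((measurable_maxValue_mapCov μ₀ S₀ n).comp measurable_fst).const_mul _)

/-- Source of exchangeability: the observations enter through a sum, a symmetry not visible in the
product of t densities. -/
theorem maxLikelihood_comp_perm (n : ℕ) (π : Equiv.Perm (Fin n)) (x : Fin n → Fin m → ℝ) :
    maxLikelihood normalDensity (luckiness ν μ₀ S₀ ρ) (x ∘ π) =
      maxLikelihood normalDensity (luckiness ν μ₀ S₀ ρ) x := by
  unfold maxLikelihood
  refine iSup_congr fun θ => ?_
  congr 1
  unfold normalDensity
  have h := Equiv.sum_comp π fun i => (x i - θ.1) ⬝ᵥ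
    ((θ.2 : Matrix (Fin m) (Fin m) ℝ)⁻¹ *ᵥ (x i - θ.1))
  simp only [Function.comp_apply, h]

end Sequential

end LNML

/-! ### The main theorem -/

theorem corollary1 (m : ℕ) (hm : 1 ≤ m) (ν : ℝ) (hν : (m : ℝ) - 1 < ν)
    (μ₀ : Fin m → ℝ) (S₀ : Matrix (Fin m) (Fin m) ℝ) (hS₀ : S₀.PosDef)
    (ρ : ℝ) (hρ : 0 < ρ ^ 2) :
    -- the LNML is well defined: the maximum is attained, at the MAP estimates,
    -- and the capacity is a positive finite integral
    (∀ (n : ℕ) (x : Fin n → Fin m → ℝ), ∃ θ : LNML.NormalParam m,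
      θ.1 = LNML.mapMean ν μ₀ ρ x ∧
      (θ.2 : Matrix (Fin m) (Fin m) ℝ) = LNML.mapCov ν μ₀ S₀ ρ x ∧
      ∀ θ' : LNML.NormalParam m,
        LNML.normalDensity θ' x * LNML.luckiness ν μ₀ S₀ ρ θ' ≤
          LNML.normalDensity θ x * LNML.luckiness ν μ₀ S₀ ρ θ) ∧
    (∀ n : ℕ,
      Integrable (fun x : Fin n → Fin m → ℝ =>
        LNML.maxLikelihood LNML.normalDensity (LNML.luckiness ν μ₀ S₀ ρ) x) ∧
      0 < LNML.capacity (X := Fin n → Fin m → ℝ) LNML.normalDensity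
        (LNML.luckiness ν μ₀ S₀ ρ)) ∧
    -- every sequential factor is a genuine multivariate t density
    (∀ (k : ℕ) (z : Fin k → Fin m → ℝ),
      0 < LNML.tDof m ν (k + 1) ∧
      (LNML.scaleFactor m ν ρ (k + 1) • LNML.mapCov ν μ₀ S₀ ρ z).PosDef ∧
      ∫⁻ y, ENNReal.ofReal (LNML.predictiveDensity ν μ₀ S₀ ρ z y) = 1) ∧
    -- the sequential decomposition
    (∀ (n : ℕ) (x : Fin n → Fin m → ℝ),
      LNML.normalLNML ν μ₀ S₀ ρ x =
        ∏ i : Fin n, LNML.predictiveDensity ν μ₀ S₀ ρ (Fin.take i i.isLt.le x) (x i)) ∧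
    -- the LNML densities are the finite-dimensional densities of exactly one process,
    -- and this process is exchangeable
    (∃ P : Measure (ℕ → Fin m → ℝ),
      IsProbabilityMeasure P ∧
      (∀ n : ℕ, P.map (fun ω (i : Fin n) => ω i) =
        volume.withDensity (fun x => ENNReal.ofReal (LNML.normalLNML ν μ₀ S₀ ρ x))) ∧
      LNML.Exchangeable P ∧
      ∀ Q : Measure (ℕ → Fin m → ℝ),
        (∀ n : ℕ, Q.map (fun ω (i : Fin n) => ω i) =
          volume.withDensity (fun x => ENNReal.ofReal (LNML.normalLNML ν μ₀ S₀ ρ x))) →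
        Q = P) := by
  -- The only use of `m ≥ 1`.
  have hν₀ : 0 < ν := by
    have : (1 : ℝ) ≤ m := by exact_mod_cast hm
    linarith
  obtain ⟨P, hPprob, hP⟩ := LNML.exists_process (E := Fin m → ℝ)
    (fun n x => ENNReal.ofReal (LNML.predictiveProduct ν μ₀ S₀ ρ n x))
    (fun n z y => ENNReal.ofReal (LNML.predictiveDensity ν μ₀ S₀ ρ z y))
    (fun n => (LNML.measurable_predictiveProduct μ₀ S₀ hν₀ hν hρ hS₀ n).ennreal_ofReal)
    (fun n => (LNML.measurable_predictiveDensity μ₀ S₀ hν₀ hν hρ hS₀ n).ennreal_ofReal)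
    (fun n z => LNML.lintegral_tDensity (LNML.tDof_pos hν n) _
      (LNML.posDef_scaleFactor_smul_mapCov μ₀ S₀ hν₀ hν hρ hS₀ z))
    (fun x => by simp [LNML.predictiveProduct])
    (fun n z y => by
      rw [LNML.predictiveProduct_snoc, ENNReal.ofReal_mul
        (LNML.predictiveProduct_nonneg μ₀ S₀ hν₀ hν hρ hS₀ n z)])
  have hmeas := LNML.measurable_predictiveProduct μ₀ S₀ hν₀ hν hρ hS₀
  have hnn := LNML.predictiveProduct_nonneg μ₀ S₀ hν₀ hν hρ hS₀
  -- The product is the density of a marginal of the probability measure `P`, so no iterated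
  -- integration is needed.
  have hone : ∀ n, ∫⁻ x, ENNReal.ofReal (LNML.predictiveProduct ν μ₀ S₀ ρ n x) = 1 := by
    intro n
    have hmap : Measurable fun (ω : ℕ → Fin m → ℝ) (i : Fin n) => ω i := by fun_prop
    have h := Measure.isProbabilityMeasure_map (μ := P) hmap.aemeasurable
    rw [hP n] at h
    have h1 := h.measure_univ
    rwa [withDensity_apply _ .univ, Measure.restrict_univ] at h1
  have hint : ∀ n, Integrable (LNML.predictiveProduct ν μ₀ S₀ ρ n) := fun n =>
    (lintegral_ofReal_ne_top_iff_integrable (hmeas n).aestronglyMeasurable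
      (Filter.Eventually.of_forall (hnn n))).1 (by rw [hone]; exact ENNReal.one_ne_top)
  have hint_one : ∀ n, ∫ x, LNML.predictiveProduct ν μ₀ S₀ ρ n x = 1 := fun n => by
    rw [integral_eq_lintegral_of_nonneg_ae (Filter.Eventually.of_forall (hnn n))
      (hmeas n).aestronglyMeasurable, hone, ENNReal.toReal_one]
  have hmax : ∀ n, ∃ C : ℝ, 0 < C ∧
      (LNML.maxLikelihood LNML.normalDensity (LNML.luckiness ν μ₀ S₀ ρ) :
        (Fin n → Fin m → ℝ) → ℝ) = fun x => C * LNML.predictiveProduct ν μ₀ S₀ ρ n x := by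
    intro n
    obtain ⟨C, hC, h⟩ :=
      LNML.exists_maxValue_eq_mul_predictiveProduct μ₀ S₀ hν₀ hν hρ hS₀ n
    exact ⟨C, hC, funext fun x => by rw [LNML.maxLikelihood_eq μ₀ S₀ hν₀ hρ hS₀, h]⟩
  -- Since the product integrates to one, the unspecified constant is the capacity.
  have hcap : ∀ (n : ℕ) (C : ℝ),
      (LNML.maxLikelihood LNML.normalDensity (LNML.luckiness ν μ₀ S₀ ρ) :
        (Fin n → Fin m → ℝ) → ℝ) = (fun x => C * LNML.predictiveProduct ν μ₀ S₀ ρ n x) →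
      LNML.capacity (X := Fin n → Fin m → ℝ) LNML.normalDensity
        (LNML.luckiness ν μ₀ S₀ ρ) = C := by
    intro n C h
    rw [LNML.capacity, h, integral_const_mul, hint_one, mul_one]
  have hdens : ∀ n, (LNML.normalLNML ν μ₀ S₀ ρ : (Fin n → Fin m → ℝ) → ℝ) =
      LNML.predictiveProduct ν μ₀ S₀ ρ n := by
    intro n
    obtain ⟨C, hC, h⟩ := hmax n
    funext x
    rw [LNML.normalLNML, LNML.density, hcap n C h, h]
    field_simp
  refine ⟨fun n x => ⟨LNML.mapParam μ₀ S₀ hν₀ hρ hS₀ x, rfl, rfl, fun θ' => ?_⟩, fun n => ?_,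
    fun k z => ⟨LNML.tDof_pos hν k, LNML.posDef_scaleFactor_smul_mapCov μ₀ S₀ hν₀ hν hρ hS₀ z,
      LNML.lintegral_tDensity (LNML.tDof_pos hν k) _
        (LNML.posDef_scaleFactor_smul_mapCov μ₀ S₀ hν₀ hν hρ hS₀ z)⟩,
    fun n x => congrFun (hdens n) x, P, hPprob, fun n => ?_, ?_, fun Q hQ => ?_⟩
  · rw [LNML.normalDensity_mul_luckiness_mapParam]
    exact LNML.normalDensity_mul_luckiness_le μ₀ S₀ hν₀ hρ hS₀ x θ'
  · obtain ⟨C, hC, h⟩ := hmax n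
    rw [hcap n C h]
    exact ⟨h ▸ (hint n).const_mul C, hC⟩
  · rw [hP, hdens]
  · refine LNML.exchangeable_of_symmetric (fun n => (hmeas n).ennreal_ofReal)
      (fun n π x => ?_) hP
    -- Return from the product to the maximized likelihood, where the symmetry is evident.
    rw [← hdens, LNML.normalLNML, LNML.normalLNML, LNML.density, LNML.density,
      LNML.maxLikelihood_comp_perm]
  · refine LNML.ext_of_map_initial 0 fun n _ => ?_
    rw [hQ, hP, hdens]
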